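/- \textbf{Theorem} (Gr\"atzer--Schmidt, 1962). Let $D$ be a finite distributive lattice (lattices are nonempty). Then there exists a finite sectionally complemented lattice $L$ such that $D$ is isomorphic to $\operatorname{Con} L$, the lattice of all congruence relations of $L$ ordered by inclusion. Here a lattice $L$ with least element $0$ is \emph{sectionally complemented} if for all $a \le b$ in $L$ there is $c \in L$ with $a \wedge c = 0$ and $a \vee c = b$. -/

import Mathlib

universe u

/-- Congruences of a lattice, ordered by inclusion: `c ≤ d` iff every pair identified by `c` is
identified by `d`. -/
instance LatticeCon.instPartialOrder {L : Type*} [Lattice L] : PartialOrder (LatticeCon L) where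
  le c d := ∀ ⦃x y : L⦄, c.r x y → d.r x y
  le_refl _ _ _ h := h
  le_trans _ _ _ hcd hde _ _ h := hde (hcd h)
  le_antisymm c d hcd hdc := by
    cases c with | mk c _ _ => ?_
    cases d with | mk d _ _ => ?_
    have h : c = d := Setoid.ext fun x y => ⟨fun h => hcd h, fun h => hdc h⟩
    subst h
    rfl

/-- The infimum of a set of congruences is their intersection. -/
instance LatticeCon.instInfSet {L : Type*} [Lattice L] : InfSet (LatticeCon L) where
  sInf S :=
    { r := fun x y => ∀ c ∈ S, c.r x y
      iseqv := ⟨fun x c _ => c.refl x, fun h c hc => c.symm (h c hc),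
        fun h₁ h₂ c hc => c.trans (h₁ c hc) (h₂ c hc)⟩
      inf := fun h₁ h₂ c hc => c.inf (h₁ c hc) (h₂ c hc)
      sup := fun h₁ h₂ c hc => c.sup (h₁ c hc) (h₂ c hc) }

/-- The congruence lattice `Con L`: all congruences of `L`, ordered by inclusion, form a
(complete) lattice. -/
instance LatticeCon.instCompleteLattice {L : Type*} [Lattice L] :
    CompleteLattice (LatticeCon L) :=
  completeLatticeOfInf (LatticeCon L) fun _ =>
    ⟨fun _ hc _ _ h => h _ hc, fun _ hd _ _ h c hc => hd hc h⟩

/-- A lattice with least element `⊥` is sectionally complemented if, for all `a ≤ b`, the element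
`a` has a complement in the interval `[⊥, b]`. -/
def IsSectionallyComplemented (L : Type*) [Lattice L] [OrderBot L] : Prop :=
  ∀ a b : L, a ≤ b → ∃ c : L, a ⊓ c = ⊥ ∧ a ⊔ c = b

/-! By Birkhoff, `D` is the lattice of lower sets of its poset `P` of sup-irreducibles, so it
suffices to realise `LowerSet P` as a congruence lattice. In the lattice of closed sets, for `q < p`
each atom over `q` lies below the join of `main p` with the other atom over `q`. Hence a congruence
collapsing an atom over `p` collapses all atoms over `p` and over every `q < p`. By
`le_con_collapsed` and `con_collapsed_le`, the collapsed atoms determine the congruence; `con` shows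
that every lower set occurs. -/

namespace GratzerSchmidt

variable {P : Type u} [PartialOrder P]

/-- The atoms over a poset: each `p` has a main atom `(p, false)`, and each non-maximal `p` also
has a second atom `(p, true)`. -/
def Atom (P : Type u) [PartialOrder P] : Type u :=
  {x : P × Bool // x.2 = true → ¬ IsMax x.1}

namespace Atom

/-- The element of the poset over which an atom lies. -/
def idx (a : Atom P) : P := a.1.1

/-- The main atom over `p`. -/
def main (p : P) : Atom P := ⟨(p, false), fun h => absurd h (by simp)⟩

@[simp] lemma idx_main (p : P) : (main p).idx = p := rfl

lemma exists_lt_of_ne {a b : Atom P} (h : a.idx = b.idx) (hne : a ≠ b) : ∃ p, a.idx < p := by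
  obtain ⟨⟨p, i⟩, ha⟩ := a
  obtain ⟨⟨q, j⟩, hb⟩ := b
  obtain rfl : p = q := h
  refine not_isMax_iff.1 ?_
  cases i <;> cases j
  · exact absurd rfl hne
  · exact hb rfl
  · exact ha rfl
  · exact absurd rfl hne

lemma exists_ne {b : Atom P} {p : P} (h : b.idx < p) : ∃ a : Atom P, a.idx = b.idx ∧ a ≠ b := by
  obtain ⟨⟨q, i⟩, hb⟩ := b
  have hq : ¬ IsMax q := not_isMax_iff.2 ⟨p, h⟩
  refine ⟨⟨(q, !i), fun _ => hq⟩, rfl, fun h' => ?_⟩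
  have : (!i) = i := congrArg (fun x : Atom P => x.1.2) h'
  cases i <;> simp at this

instance [Finite P] : Finite (Atom P) := Subtype.finite

end Atom

open Atom

/-- A set of atoms is closed if, whenever it contains the main atom of `p` and some atom over
`q < p`, it contains all atoms over `q`. -/
def IsClosedSet (A : Set (Atom P)) : Prop :=
  ∀ ⦃p : P⦄ ⦃a b : Atom P⦄, a.idx < p → b.idx = a.idx → main p ∈ A → a ∈ A → b ∈ A

/-- The closed sets of atoms. -/
def ClosedSet (P : Type u) [PartialOrder P] : Type u := {A : Set (Atom P) // IsClosedSet A}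

namespace ClosedSet

instance : SetLike (ClosedSet P) (Atom P) := ⟨Subtype.val, Subtype.val_injective⟩

instance : PartialOrder (ClosedSet P) := .ofSetLike (ClosedSet P) (Atom P)

instance [Finite P] : Finite (ClosedSet P) := Subtype.finite

lemma closed (A : ClosedSet P) : IsClosedSet (A : Set (Atom P)) := A.2

instance : InfSet (ClosedSet P) where
  sInf S := ⟨{x | ∀ A ∈ S, x ∈ A}, fun _ _ _ h h' hp ha A hA =>
    A.closed h h' (hp A hA) (ha A hA)⟩

instance : CompleteLattice (ClosedSet P) :=
  { completeLatticeOfInf (ClosedSet P) fun _ =>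
      ⟨fun _ hA _ hx => hx _ hA, fun _ hB _ hx _ hA => hB hA hx⟩ with
    inf := fun A B => ⟨{x | x ∈ A ∧ x ∈ B}, fun _ _ _ h h' hp ha =>
      ⟨A.closed h h' hp.1 ha.1, B.closed h h' hp.2 ha.2⟩⟩
    inf_le_left := fun _ _ _ hx => hx.1
    inf_le_right := fun _ _ _ hx => hx.2
    le_inf := fun _ _ _ h₁ h₂ _ hx => ⟨h₁ hx, h₂ hx⟩
    bot := ⟨∅, fun _ _ _ _ _ hp => hp.elim⟩
    bot_le := fun _ _ hx => hx.elim }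

/-- The closed set consisting of one atom. -/
def single (a : Atom P) : ClosedSet P :=
  ⟨{a}, fun _ _ _ h _ hp hx => by
    rw [Set.mem_singleton_iff] at hp hx
    rw [hx, ← hp] at h
    exact absurd h (lt_irrefl _)⟩

@[simp] lemma mem_single {a x : Atom P} : x ∈ single a ↔ x = a := Iff.rfl

lemma single_le {a : Atom P} {A : ClosedSet P} : single a ≤ A ↔ a ∈ A :=
  ⟨fun h => h rfl, fun h x hx => by rwa [mem_single.1 hx]⟩

lemma single_inf_eq_bot {a : Atom P} {A : ClosedSet P} (h : a ∉ A) : single a ⊓ A = ⊥ :=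
  le_bot_iff.1 fun _ hx => (h (mem_single.1 hx.1 ▸ hx.2)).elim

lemma single_le_sup {p : P} {a b : Atom P} (h : a.idx < p) (hab : b.idx = a.idx) :
    single b ≤ single (main p) ⊔ single a :=
  single_le.2 ((single (main p) ⊔ single a).closed h hab
    (single_le.1 le_sup_left) (single_le.1 le_sup_right))

theorem isSectionallyComplemented [Finite P] : IsSectionallyComplemented (ClosedSet P) := by
  intro A B hAB
  -- The set difference `B \ A` need not be closed: an atom outside `A` and some `main p` may
  -- generate the companion atom lying in `A`. Atoms at risk of this are dropped.
  let C : ClosedSet P := ⟨{a | (a ∈ B ∧ a ∉ A) ∧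
    ∀ c ∈ A, c.idx = a.idx → ∀ p, a.idx < p → main p ∈ B → main p ∈ A}, by
    rintro p a b hap hba ⟨⟨hpB, hpA⟩, -⟩ ⟨⟨haB, haA⟩, ha⟩
    refine ⟨⟨B.closed hap hba hpB haB, fun hb => hpA (ha b hb hba p hap hpB)⟩, ?_⟩
    rw [hba]
    exact ha⟩
  refine ⟨C, le_bot_iff.1 fun _ hx => (hx.2.1.2 hx.1).elim,
    le_antisymm (sup_le hAB fun _ hx => hx.1.1) fun a haB => ?_⟩
  by_cases haA : a ∈ A
  · exact (le_sup_left : A ≤ A ⊔ C) haA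
  by_cases haC : a ∈ C
  · exact (le_sup_right : C ≤ A ⊔ C) haC
  obtain ⟨c, hcA, hca, p, hap, hpB, hpA⟩ : ∃ c ∈ A, c.idx = a.idx ∧
      ∃ p, a.idx < p ∧ main p ∈ B ∧ main p ∉ A := by
    by_contra! h
    exact haC ⟨⟨haB, haA⟩, h⟩
  -- Maximality keeps `main q` from being dropped; with the companion `c ∈ A` it then regenerates
  -- `a`.
  obtain ⟨q, -, hq⟩ := (Set.toFinite {p | a.idx < p ∧ main p ∈ B ∧ main p ∉ A}).exists_le_maximal
    (show p ∈ {p | a.idx < p ∧ main p ∈ B ∧ main p ∉ A} from ⟨hap, hpB, hpA⟩)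
  have hqC : main q ∈ C := by
    refine ⟨hq.prop.2, fun _ _ _ r hr hrB => ?_⟩
    by_contra hrA
    exact hq.not_gt ⟨hq.prop.1.trans hr, hrB, hrA⟩ hr
  exact (A ⊔ C).closed (hca ▸ hq.prop.1) hca.symm
    ((le_sup_right : C ≤ A ⊔ C) hqC) ((le_sup_left : A ≤ A ⊔ C) hcA)

/-- Enlarging a closed set by all atoms over a lower set. -/
def expand (H : LowerSet P) (A : ClosedSet P) : ClosedSet P :=
  ⟨{x | x.idx ∈ H ∨ x ∈ A}, by
    rintro p a b hap hba hp (ha | ha)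
    · exact .inl (hba ▸ ha)
    · rcases hp with hp | hp
      · exact .inl (hba ▸ H.lower hap.le hp)
      · exact .inr (A.closed hap hba hp ha)⟩

lemma le_expand (H : LowerSet P) (A : ClosedSet P) : A ≤ expand H A := fun _ => .inr

lemma expand_le_expand {H : LowerSet P} {A B : ClosedSet P} :
    expand H A ≤ expand H B ↔ A ≤ expand H B :=
  ⟨(le_expand H A).trans, fun h _ hx => hx.elim .inl fun hx => h hx⟩

lemma expand_mono (H : LowerSet P) : Monotone (expand H : ClosedSet P → ClosedSet P) :=
  fun _ B h => expand_le_expand.2 (h.trans (le_expand H B))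

lemma expand_inf (H : LowerSet P) (A B : ClosedSet P) :
    expand H (A ⊓ B) = expand H A ⊓ expand H B :=
  SetLike.ext fun _ => or_and_left

lemma expand_sup_le {H : LowerSet P} {A B C D : ClosedSet P}
    (h₁ : expand H A = expand H B) (h₂ : expand H C = expand H D) :
    expand H (A ⊔ C) ≤ expand H (B ⊔ D) :=
  expand_le_expand.2 <| sup_le
    ((le_expand H A).trans (h₁.le.trans (expand_mono H le_sup_left)))
    ((le_expand H C).trans (h₂.le.trans (expand_mono H le_sup_right)))

/-- The congruence identifying closed sets that agree outside the atoms over a lower set. -/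
def con (H : LowerSet P) : LatticeCon (ClosedSet P) where
  r A B := expand H A = expand H B
  iseqv := ⟨fun _ => rfl, Eq.symm, Eq.trans⟩
  inf h₁ h₂ := by rw [expand_inf, expand_inf, h₁, h₂]
  sup h₁ h₂ := le_antisymm (expand_sup_le h₁ h₂) (expand_sup_le h₁.symm h₂.symm)

lemma con_single_bot {H : LowerSet P} {a : Atom P} : (con H).r (single a) ⊥ ↔ a.idx ∈ H := by
  refine ⟨fun h => ?_, fun h => le_antisymm (expand_le_expand.2 (single_le.2 (.inl h)))
    (expand_mono H bot_le)⟩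
  exact (h.le (.inr rfl) : a ∈ expand H ⊥).elim id fun h => h.elim

lemma con_le_con {H K : LowerSet P} : con H ≤ con K ↔ H ≤ K := by
  refine ⟨fun h p hp => ?_, fun h A B hAB => ?_⟩
  · exact con_single_bot.1 (h (con_single_bot.2 (show (main p).idx ∈ H from hp)))
  · have key : ∀ {A B : ClosedSet P}, expand H A = expand H B → expand K A ≤ expand K B :=
      fun h' => expand_le_expand.2 fun x hx =>
        (h'.le (.inr hx) : x ∈ expand H _).elim (fun hx => .inl (h hx)) .inr
    exact le_antisymm (key hAB) (key hAB.symm)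

section Congruence

variable (c : LatticeCon (ClosedSet P))

/-- If `b ≤ x ⊔ y` is an atom outside `y` and `x` is congruent to `⊥`, then so is `b`. -/
lemma single_bot_of_le_sup {x y : ClosedSet P} {b : Atom P} (hx : c.r x ⊥) (hb : b ∉ y)
    (hle : single b ≤ x ⊔ y) : c.r (single b) ⊥ := by
  have h := c.inf (c.refl (single b)) (c.sup hx (c.refl y))
  rwa [inf_eq_left.2 hle, bot_sup_eq, single_inf_eq_bot hb] at h

lemma single_bot_of_idx_eq {a b : Atom P} (h : c.r (single a) ⊥) (hab : b.idx = a.idx) :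
    c.r (single b) ⊥ := by
  by_cases hne : b = a
  · rwa [hne]
  obtain ⟨p, hp⟩ := exists_lt_of_ne hab hne
  refine single_bot_of_le_sup c (y := single (main p)) h (fun hb => ?_)
    ((single_le_sup (hab ▸ hp) hab).trans_eq (sup_comm _ _))
  rw [mem_single.1 hb] at hp
  exact lt_irrefl _ hp

/-- Non-maximality of `b.idx` supplies a second atom `d` over it, and `b` lies below the join of `d`
with the collapsed main atom over `a.idx`. -/
lemma single_bot_of_idx_lt {a b : Atom P} (h : c.r (single a) ⊥) (hba : b.idx < a.idx) :
    c.r (single b) ⊥ := by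
  obtain ⟨d, hd, hne⟩ := exists_ne hba
  exact single_bot_of_le_sup c (single_bot_of_idx_eq c h (idx_main _))
    (fun hb => hne (mem_single.1 hb).symm) (single_le_sup (hd ▸ hba) hd.symm)

/-- The elements of the poset whose atoms a congruence collapses. -/
def collapsed : LowerSet P where
  carrier := {p | c.r (single (main p)) ⊥}
  lower' _ _ h hp := h.lt_or_eq.elim (fun h => single_bot_of_idx_lt c hp h) fun h => h ▸ hp

lemma idx_mem_collapsed {a : Atom P} : a.idx ∈ collapsed c ↔ c.r (single a) ⊥ :=
  ⟨fun h => single_bot_of_idx_eq c h rfl, fun h => single_bot_of_idx_eq c h rfl⟩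

lemma le_con_collapsed : c ≤ con (collapsed c) := by
  have key : ∀ {A B : ClosedSet P}, c.r A B → A ≤ expand (collapsed c) B := by
    intro A B h a ha
    by_cases hb : a ∈ B
    · exact .inr hb
    -- Meeting both sides with an atom of `A` outside `B` collapses that atom.
    have h' := c.inf (c.refl (single a)) h
    rw [inf_eq_left.2 (single_le.2 ha), single_inf_eq_bot hb] at h'
    exact .inl ((idx_mem_collapsed c).2 h')
  exact fun A B h => le_antisymm (expand_le_expand.2 (key h))
    (expand_le_expand.2 (key (c.symm h)))

lemma con_collapsed_le [Finite P] : con (collapsed c) ≤ c := by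
  classical
  cases nonempty_fintype (ClosedSet P)
  -- By finiteness the largest element congruent to `⊥` exists; joining with it stays within each
  -- class and absorbs every collapsed atom.
  let T : ClosedSet P := ({A | c.r A ⊥} : Finset (ClosedSet P)).sup id
  have hT : c.r T ⊥ := by
    refine Finset.sup_induction (p := fun A => c.r A ⊥) (c.refl ⊥) (fun A hA B hB => ?_)
      fun A hA => (Finset.mem_filter.1 hA).2
    simpa using c.sup hA hB
  have hsup : ∀ A, c.r (A ⊔ T) A := fun A => by simpa using c.sup (c.refl A) hT
  have key : ∀ {A B : ClosedSet P}, (con (collapsed c)).r A B → A ⊔ T ≤ B ⊔ T := by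
    intro A B h
    refine sup_le (fun a ha => ?_) le_sup_right
    rcases (h.le (.inr ha) : a ∈ expand (collapsed c) B) with ha | ha
    · have : single a ≤ T := Finset.le_sup (f := id)
        (Finset.mem_filter.2 ⟨Finset.mem_univ _, (idx_mem_collapsed c).1 ha⟩)
      exact single_le.1 (this.trans le_sup_right)
    · exact (le_sup_left : B ≤ B ⊔ T) ha
  intro A B h
  have hB := hsup B
  rw [← le_antisymm (key h) (key ((con (collapsed c)).symm h))] at hB
  exact c.trans (c.symm (hsup A)) hB

end Congruence

/-- The congruence lattice of the closed sets of atoms is the lattice of lower sets. -/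
noncomputable def lowerSetIsoCon [Finite P] : LowerSet P ≃o LatticeCon (ClosedSet P) :=
  RelIso.ofSurjective (OrderEmbedding.ofMapLEIff con fun _ _ => con_le_con)
    fun c => ⟨collapsed c, le_antisymm (con_collapsed_le c) (le_con_collapsed c)⟩

end ClosedSet

end GratzerSchmidt

theorem theoremT (D : Type u) [DistribLattice D] [Finite D] [Nonempty D] :
    ∃ (L : Type u) (_ : Lattice L) (_ : OrderBot L),
      Finite L ∧ IsSectionallyComplemented L ∧ Nonempty (D ≃o LatticeCon L) := by
  classical
  cases nonempty_fintype D
  let _ : OrderBot D := Fintype.toOrderBot D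
  exact ⟨GratzerSchmidt.ClosedSet {a : D // SupIrred a}, inferInstance, inferInstance,
    inferInstance, GratzerSchmidt.ClosedSet.isSectionallyComplemented,
    ⟨OrderIso.lowerSetSupIrred.trans GratzerSchmidt.ClosedSet.lowerSetIsoCon⟩⟩
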